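/- Let $d\ge 0$ and $m\ge 2$ be integers, let $\mathcal H=\mathbb C^d$ be a $d$-dimensional Hilbert space and $\mathcal H_{\mathrm{anc}}=\mathbb C^m$ the Hilbert space of an ancillary system. Let $|\chi_1\rangle,\dots,|\chi_d\rangle\in\mathcal H$ be unit vectors (the classical pure states) that are linearly independent and span $\mathcal H$. Definitions. A state $\rho$ on $\mathcal H$ (a density operator) is classical if it lies in the convex hull of the $|\chi_i\rangle\langle\chi_i|$, and nonclassical otherwise. The nonclassical rank of a vector $|\psi\rangle$ is the least $r$ such that $|\psi\rangle$ is a linear combination, with nonzero complex coefficients, of $r$ of the $|\chi_i\rangle$. The nonclassical number $N(\rho)$ is the minimum, over all finite pure-state convex decompositions $\rho=\sum_i p_i|\psi_i\rangle\langle\psi_i|$, of the largest nonclassical rank among the $|\psi_i\rangle$. A pure state of a system of finitely many parties is $k$-producible if it is a tensor product of vectors each pertaining to a block of at most $k$ parties of some partition of the parties; a mixed state is $k$-producible if it is a convex combination of $k$-producible pure states. A state is genuinely $k$-partite entangled (has entanglement depth $k$) if it is $k$-producible but not $(k-1)$-producible, and it is fully separable if it is $1$-producible. Claim. There is an isometry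 $\Lambda:\mathcal H\to\mathcal H\otimes\mathcal H_{\mathrm{anc}}^{\otimes d}$ such that, with respect to the $d+1$ parties (the system and the $d$ ancillas), for every state $\rho$ on $\mathcal H$ with nonclassical number $N(\rho)=k$: 1. $\Lambda\rho\Lambda^\dagger$ is genuinely $(k+1)$-partite entangled if and only if $\rho$ is nonclassical, and $\rho$ is nonclassical if and only if $2\le k\le d$; 2. $\Lambda\rho\Lambda^\dagger$ is fully separable if and only if $\rho$ is classical, and $\rho$ is classical if and only if $k=1$. Moreover, for every state $\rho$ and every $k$ with $2\le k\le d$, $\Lambda\rho\Lambda^\dagger$ is genuinely $(k+1)$-partite entangled if and only if $N(\rho)=k$. -/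

import Mathlib

noncomputable section

/-! ## States -/

section States

variable {H : Type*} [NormedAddCommGroup H] [InnerProductSpace ℂ H]

/-- The rank-one operator `|ψ⟩⟨ψ|`. -/
def ketbra (ψ : H) : H →L[ℂ] H := InnerProductSpace.rankOne ℂ ψ ψ

/-- Density operators: positive semidefinite operators of trace one. -/
def IsDensityOperator (ρ : H →L[ℂ] H) : Prop :=
  ρ.IsPositive ∧ LinearMap.trace ℂ H (ρ : H →ₗ[ℂ] H) = 1

/-- `{p i, |ψ i⟩}` is a (finite) pure-state convex decomposition of `ρ`:
`ρ = ∑ i, p i |ψ i⟩⟨ψ i|` with normalized `ψ i` and `p` a probability vector. -/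
def IsPureDecomposition (ρ : H →L[ℂ] H) {n : ℕ} (p : Fin n → ℝ) (ψ : Fin n → H) : Prop :=
  (∀ i, 0 ≤ p i) ∧ ∑ i, p i = 1 ∧ (∀ i, ‖ψ i‖ = 1) ∧ ρ = ∑ i, (p i : ℂ) • ketbra (ψ i)

end States

/-! ## Nonclassicality relative to a finite family `χ` of classical pure states -/

section Nonclassicality

variable {H : Type*} [NormedAddCommGroup H] [InnerProductSpace ℂ H]
variable {ι : Type*}

/-- Classical states: the convex hull of the classical pure states `|χ i⟩⟨χ i|`. -/
def IsClassical (χ : ι → H) (ρ : H →L[ℂ] H) : Prop :=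
  ρ ∈ convexHull ℝ (Set.range fun i => ketbra (χ i))

/-- Nonclassical rank: the least number of classical pure states in an expansion of `ψ` with
nonzero complex coefficients. -/
def nonclassicalRank (χ : ι → H) (ψ : H) : ℕ :=
  sInf {r | ∃ (s : Finset ι) (c : ι → ℂ),
    s.card = r ∧ (∀ i ∈ s, c i ≠ 0) ∧ ψ = ∑ i ∈ s, c i • χ i}

/-- Nonclassical number: the minimum over all pure-state convex decompositions of `ρ` of the
largest nonclassical rank occurring in the decomposition. -/
def nonclassicalNumber (χ : ι → H) (ρ : H →L[ℂ] H) : ℕ :=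
  sInf {r | ∃ (n : ℕ) (p : Fin n → ℝ) (ψ : Fin n → H), IsPureDecomposition ρ p ψ ∧
    Finset.univ.sup (fun i => nonclassicalRank χ (ψ i)) = r}

end Nonclassicality

/-! ## Multipartite systems and entanglement depth -/

section Multipartite

variable {P : Type*} [Fintype P] [DecidableEq P]

/-- The Hilbert space `⨂ p, ℂ ^ dim p` of a system with parties `p : P`, a vector being given by
its coordinates in the product basis `⨂ p, |x p⟩`. -/
abbrev CompositeSpace (dim : P → ℕ) : Type _ := EuclideanSpace ℂ (∀ p, Fin (dim p))

/-- `ψ` is `k`-producible: for some partition of the set of parties into nonempty blocks of at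
most `k` parties, `ψ` is the tensor product of vectors `φ B`, one in the Hilbert space of each
block `B`. (For normalized `ψ` the factors can be rescaled to be normalized as well.) -/
def IsProducibleVector {dim : P → ℕ} (k : ℕ) (ψ : CompositeSpace dim) : Prop :=
  ∃ π : Finpartition (Finset.univ : Finset P), (∀ B ∈ π.parts, B.card ≤ k) ∧
    ∃ φ : ∀ B : Finset P, CompositeSpace (fun p : B => dim p),
      ∀ x, ψ x = ∏ B ∈ π.parts, φ B (fun p => x p)

/-- A mixed state is `k`-producible if it is a convex combination of `k`-producible pure
states. -/
def IsProducible {dim : P → ℕ} (k : ℕ)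
    (ρ : CompositeSpace dim →L[ℂ] CompositeSpace dim) : Prop :=
  ρ ∈ convexHull ℝ (ketbra '' {ψ : CompositeSpace dim | ‖ψ‖ = 1 ∧ IsProducibleVector k ψ})

/-- Genuine `k`-partite entanglement, i.e. entanglement depth `k`: `k`-producible but not
`(k - 1)`-producible. -/
def IsGenuinelyPartiteEntangled {dim : P → ℕ} (k : ℕ)
    (ρ : CompositeSpace dim →L[ℂ] CompositeSpace dim) : Prop :=
  IsProducible k ρ ∧ ¬ IsProducible (k - 1) ρ

/-- Fully separable states: the `1`-producible ones. -/
def IsFullySeparable {dim : P → ℕ}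
    (ρ : CompositeSpace dim →L[ℂ] CompositeSpace dim) : Prop :=
  IsProducible 1 ρ

end Multipartite

/-- Local dimensions of the system `ℂ ^ d ⊗ (ℂ ^ m)^{⊗ d}`: the party `none` is the original
`d`-level system, the parties `some j` are the `d` ancillas. -/
def ancillaDims (d m : ℕ) : Option (Fin d) → ℕ
  | none => d
  | some _ => m

/-- The operator `Λ ρ Λ†`. -/
def conjugateBy {H K : Type*} [NormedAddCommGroup H] [InnerProductSpace ℂ H] [CompleteSpace H]
    [NormedAddCommGroup K] [InnerProductSpace ℂ K] [CompleteSpace K]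
    (Λ : H →ₗᵢ[ℂ] K) (ρ : H →L[ℂ] H) : K →L[ℂ] K :=
  Λ.toContinuousLinearMap ∘L ρ ∘L ContinuousLinearMap.adjoint Λ.toContinuousLinearMap

end

/-! `Λ` sends the `i`-th classical state to a product state: column `i` of an invertible matrix `B`
on the system, `c|0⟩ + s|1⟩` on ancilla `i`, `|0⟩` on the other ancillas. For `i ≠ j` the ancillas
contribute the overlap `c ^ 2`, so `Λ` is an isometry once `Bᴴ * B` is the Gram matrix of `χ` with
off-diagonal entries divided by `c ^ 2`. By linear independence this is positive definite for `c`
close to 1 (`exists_gram_rescaled`).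

If `ψ` has support `S` in the basis `χ`, ancillas outside `S` factor off as `|0⟩`, leaving a block
of `|S| + 1` parties (`isProducibleVector_map`). If `|S| ≥ 2`, no ancilla of `S` can leave the
system's block (`nonclassicalRank_lt_of_isProducibleVector`). Hence `Λ ψ` is `l`-producible iff the
rank of `ψ` is at most `max 1 (l - 1)`.

For mixed states, every pure decomposition of `Λ ρ Λ†` lives in the range of `Λ` and pulls back to
`ρ` (`conjugateBy_mem_convexHull_ketbra_iff`). -/

/-! ### Pure-state decompositions and their transport along an isometry. -/

section Hulls

open InnerProductSpace

variable {H K : Type*} [NormedAddCommGroup H] [InnerProductSpace ℂ H]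
  [NormedAddCommGroup K] [InnerProductSpace ℂ K]

theorem mem_convexHull_ketbra_iff {Q : H → Prop} {ρ : H →L[ℂ] H} :
    ρ ∈ convexHull ℝ (ketbra '' {ψ : H | ‖ψ‖ = 1 ∧ Q ψ}) ↔
      ∃ (n : ℕ) (p : Fin n → ℝ) (ψ : Fin n → H), IsPureDecomposition ρ p ψ ∧ ∀ i, Q (ψ i) := by
  constructor
  · intro h
    rw [mem_convexHull_iff_exists_fintype] at h
    obtain ⟨ι, _, w, z, hw, hw1, hz, hsum⟩ := h
    choose ψ hψ hψz using hz
    let e := (Fintype.equivFin ι).symm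
    refine ⟨Fintype.card ι, w ∘ e, ψ ∘ e, ⟨fun i => hw _, ?_, fun i => (hψ _).1, ?_⟩,
      fun i => (hψ _).2⟩
    · rw [← hw1]; exact e.sum_comp w
    · rw [← hsum, ← e.sum_comp]
      simp [hψz, Complex.coe_smul]
  · rintro ⟨n, p, ψ, ⟨hp, hp1, hψ, rfl⟩, hQ⟩
    refine mem_convexHull_of_exists_fintype p (fun i => ketbra (ψ i)) hp hp1
      (fun i => ⟨ψ i, ⟨hψ i, hQ i⟩, rfl⟩) ?_
    simp [Complex.coe_smul]

theorem ketbra_smul (c : ℂ) (hc : ‖c‖ = 1) (ψ : H) : ketbra (c • ψ) = ketbra ψ := by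
  ext x
  simp only [ketbra, rankOne_apply, inner_smul_left, smul_smul]
  congr 1
  have : (starRingEnd ℂ) c * c = 1 := by
    rw [mul_comm, Complex.mul_conj, Complex.normSq_eq_norm_sq, hc]; simp
  linear_combination (inner ℂ ψ x) * this

/-- The spectral decomposition. It keeps the infimum in `nonclassicalNumber` from being the default
value 0 of `sInf ∅`. -/
theorem IsDensityOperator.exists_isPureDecomposition [FiniteDimensional ℂ H] {ρ : H →L[ℂ] H}
    (hρ : IsDensityOperator ρ) :
    ∃ (n : ℕ) (p : Fin n → ℝ) (ψ : Fin n → H), IsPureDecomposition ρ p ψ := by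
  obtain ⟨hT, htr⟩ := hρ
  refine ⟨_, hT.isSymmetric.eigenvalues rfl, hT.isSymmetric.eigenvectorBasis rfl,
    fun i => hT.toLinearMap.nonneg_eigenvalues rfl i, ?_,
    fun i => (hT.isSymmetric.eigenvectorBasis rfl).orthonormal.1 i, ?_⟩
  · have := hT.isSymmetric.trace_eq_sum_eigenvalues rfl
    rw [htr] at this
    simpa using (congrArg Complex.re this).symm
  · ext1 x
    conv_lhs => rw [← (hT.isSymmetric.eigenvectorBasis rfl).sum_repr x, map_sum]
    rw [_root_.sum_apply]
    refine Finset.sum_congr rfl fun i _ => ?_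
    have := hT.isSymmetric.apply_eigenvectorBasis rfl i
    simp only [ContinuousLinearMap.coe_coe] at this
    rw [map_smul, this]
    simp only [_root_.smul_apply, ketbra, rankOne_apply,
      OrthonormalBasis.repr_apply_apply]
    rw [smul_comm]
    rfl

variable [CompleteSpace H] [CompleteSpace K]

theorem conjugateBy_ketbra (Λ : H →ₗᵢ[ℂ] K) (ψ : H) :
    conjugateBy Λ (ketbra ψ) = ketbra (Λ ψ) := by
  ext x
  simp [conjugateBy, ketbra, rankOne_apply, ContinuousLinearMap.adjoint_inner_right]

theorem conjugateBy_sum_smul (Λ : H →ₗᵢ[ℂ] K) {n : ℕ} (p : Fin n → ℂ) (T : Fin n → H →L[ℂ] H) :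
    conjugateBy Λ (∑ i, p i • T i) = ∑ i, p i • conjugateBy Λ (T i) := by
  ext x
  simp [conjugateBy]

theorem adjoint_apply_self (Λ : H →ₗᵢ[ℂ] K) (ψ : H) :
    ContinuousLinearMap.adjoint Λ.toContinuousLinearMap (Λ ψ) = ψ := by
  refine ext_inner_right ℂ fun v => ?_
  rw [ContinuousLinearMap.adjoint_inner_left]
  exact Λ.inner_map_map _ _

/-- The components of positive weight in a pure decomposition of `Λ ρ Λ†` lie in the range of `Λ`. -/
theorem mem_range_of_conjugateBy_eq_sum [FiniteDimensional ℂ H] (Λ : H →ₗᵢ[ℂ] K) {ρ : H →L[ℂ] H}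
    {n : ℕ} {p : Fin n → ℝ} {φ : Fin n → K} (h : IsPureDecomposition (conjugateBy Λ ρ) p φ)
    {i : Fin n} (hi : p i ≠ 0) : φ i ∈ LinearMap.range Λ.toLinearMap := by
  obtain ⟨hp, -, -, hsum⟩ := h
  rw [← Submodule.orthogonal_orthogonal (LinearMap.range Λ.toLinearMap)]
  refine (Submodule.mem_orthogonal' _ _).2 fun x hx => ?_
  have hadj : ContinuousLinearMap.adjoint Λ.toContinuousLinearMap x = 0 := by
    refine ext_inner_right ℂ fun v => ?_
    rw [ContinuousLinearMap.adjoint_inner_left, inner_zero_left]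
    exact (Submodule.mem_orthogonal' _ _).1 hx _ ⟨v, rfl⟩
  -- The expectation of `Λ ρ Λ†` at a vector `x` orthogonal to the range vanishes, and it is a sum
  -- of nonnegative terms.
  have h0 : ∑ j, (p j : ℂ) * (inner ℂ (φ j) x * inner ℂ x (φ j)) = 0 := by
    have := congrArg (fun T => inner ℂ x (T x)) hsum
    simp only [conjugateBy, ContinuousLinearMap.comp_apply, hadj, map_zero, inner_zero_right,
      _root_.sum_apply, _root_.smul_apply, ketbra, rankOne_apply,
      inner_sum, inner_smul_right] at this
    exact this.symm
  have h1 : ∑ j, p j * ‖inner ℂ (φ j) x‖ ^ 2 = 0 := by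
    have : ∀ j, (p j : ℂ) * (inner ℂ (φ j) x * inner ℂ x (φ j)) =
        ((p j * ‖inner ℂ (φ j) x‖ ^ 2 : ℝ) : ℂ) := by
      intro j
      rw [← inner_conj_symm x (φ j), Complex.mul_conj, Complex.normSq_eq_norm_sq]
      push_cast; rfl
    simp_rw [this] at h0
    exact_mod_cast h0
  have h2 := (Finset.sum_eq_zero_iff_of_nonneg
    (fun j _ => mul_nonneg (hp j) (sq_nonneg _))).1 h1 i (Finset.mem_univ i)
  simpa [hi] using h2

theorem conjugateBy_mem_convexHull_ketbra_iff [FiniteDimensional ℂ H] (Λ : H →ₗᵢ[ℂ] K)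
    (Q : K → Prop) (ρ : H →L[ℂ] H) :
    conjugateBy Λ ρ ∈ convexHull ℝ (ketbra '' {φ : K | ‖φ‖ = 1 ∧ Q φ}) ↔
      ρ ∈ convexHull ℝ (ketbra '' {ψ : H | ‖ψ‖ = 1 ∧ Q (Λ ψ)}) := by
  constructor
  · rw [mem_convexHull_ketbra_iff]
    rintro ⟨n, p, φ, h, hQ⟩
    have hr : ∀ i, p i ≠ 0 → ∃ ψ, Λ ψ = φ i := fun i hi =>
      LinearMap.mem_range.1 (mem_range_of_conjugateBy_eq_sum Λ h hi)
    obtain ⟨hp, hp1, hφ, hsum⟩ := h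
    have hρ : ρ = ∑ i, p i • ketbra (ContinuousLinearMap.adjoint Λ.toContinuousLinearMap (φ i)) := by
      ext1 x
      have := congrArg
        (fun T => ContinuousLinearMap.adjoint Λ.toContinuousLinearMap (T (Λ x))) hsum
      simp only [conjugateBy, ContinuousLinearMap.comp_apply, adjoint_apply_self,
        LinearIsometry.coe_toContinuousLinearMap] at this
      rw [this]
      simp [ketbra, rankOne_apply, Complex.coe_smul,
        ContinuousLinearMap.adjoint_inner_left]
    -- Components of weight zero need not lie in the range of `Λ`, so they are dropped.
    rw [hρ, ← Finset.sum_filter_of_ne (p := fun i => p i ≠ 0)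
      (fun i _ hi h0 => hi (by rw [h0, zero_smul]))]
    refine (convex_convexHull ℝ _).sum_mem (fun i _ => hp i) ?_ fun i hi => ?_
    · rw [Finset.sum_filter_ne_zero, hp1]
    · obtain ⟨ψ, hψ⟩ := hr i (Finset.mem_filter.1 hi).2
      rw [← hψ, adjoint_apply_self]
      refine subset_convexHull _ _ ⟨ψ, ⟨?_, ?_⟩, rfl⟩
      · rw [← Λ.norm_map, hψ, hφ]
      · rw [hψ]; exact hQ i
  · rw [mem_convexHull_ketbra_iff, mem_convexHull_ketbra_iff]
    rintro ⟨n, p, ψ, ⟨hp, hp1, hψ, rfl⟩, hQ⟩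
    refine ⟨n, p, fun i => Λ (ψ i), ⟨hp, hp1, fun i => by rw [Λ.norm_map, hψ], ?_⟩, hQ⟩
    rw [conjugateBy_sum_smul]
    simp_rw [conjugateBy_ketbra]

end Hulls

/-! ### Nonclassical rank and number relative to a basis. -/

section Rank

variable {H : Type*} [NormedAddCommGroup H] [InnerProductSpace ℂ H]
variable {ι : Type*}

/-- Uniqueness of coordinates makes the set of admissible `r` a singleton. -/
theorem nonclassicalRank_eq_card_support (b : Module.Basis ι ℂ H) (ψ : H) :
    nonclassicalRank b ψ = (b.repr ψ).support.card := by
  classical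
  have : {r | ∃ (s : Finset ι) (c : ι → ℂ),
      s.card = r ∧ (∀ i ∈ s, c i ≠ 0) ∧ ψ = ∑ i ∈ s, c i • b i} =
      {(b.repr ψ).support.card} := by
    ext r
    constructor
    · rintro ⟨s, c, rfl, hc, rfl⟩
      rw [Set.mem_singleton_iff]
      congr 1
      ext i
      simp only [map_sum, map_smul, Module.Basis.repr_self, Finsupp.mem_support_iff,
        Finsupp.finsetSum_apply, Finsupp.smul_apply, Finsupp.single_apply, smul_eq_mul, mul_ite,
        mul_one, mul_zero, Finset.sum_ite_eq', ne_eq, ite_eq_right_iff, Classical.not_imp]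
      exact ⟨fun h => ⟨h, hc i h⟩, fun h => h.1⟩
    · rintro rfl
      exact ⟨_, b.repr ψ, rfl, fun i hi => Finsupp.mem_support_iff.1 hi,
        (b.linearCombination_repr ψ).symm⟩
  rw [nonclassicalRank, this, csInf_singleton]

theorem nonclassicalRank_pos (b : Module.Basis ι ℂ H) {ψ : H} (hψ : ‖ψ‖ = 1) :
    0 < nonclassicalRank b ψ := by
  rw [nonclassicalRank_eq_card_support, Finset.card_pos, Finsupp.support_nonempty_iff]
  intro h
  rw [(LinearEquiv.map_eq_zero_iff b.repr).1 h] at hψ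
  simp at hψ

theorem nonclassicalRank_le [Fintype ι] (b : Module.Basis ι ℂ H) (ψ : H) :
    nonclassicalRank b ψ ≤ Fintype.card ι := by
  rw [nonclassicalRank_eq_card_support]
  exact Finset.card_le_univ _

theorem exists_isPureDecomposition_sup_eq_nonclassicalNumber [FiniteDimensional ℂ H]
    {ρ : H →L[ℂ] H} (hρ : IsDensityOperator ρ) (χ : ι → H) :
    ∃ (n : ℕ) (p : Fin n → ℝ) (ψ : Fin n → H), IsPureDecomposition ρ p ψ ∧
      Finset.univ.sup (fun i => nonclassicalRank χ (ψ i)) = nonclassicalNumber χ ρ := by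
  obtain ⟨n, p, ψ, h⟩ := hρ.exists_isPureDecomposition
  exact Nat.sInf_mem (s := {r | ∃ (n : ℕ) (p : Fin n → ℝ) (ψ : Fin n → H),
    IsPureDecomposition ρ p ψ ∧ Finset.univ.sup (fun i => nonclassicalRank χ (ψ i)) = r})
    ⟨_, n, p, ψ, h, rfl⟩

theorem nonclassicalNumber_le_iff [FiniteDimensional ℂ H]
    {ρ : H →L[ℂ] H} (hρ : IsDensityOperator ρ) (χ : ι → H) (r : ℕ) :
    nonclassicalNumber χ ρ ≤ r ↔
      ρ ∈ convexHull ℝ (ketbra '' {ψ : H | ‖ψ‖ = 1 ∧ nonclassicalRank χ ψ ≤ r}) := by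
  rw [mem_convexHull_ketbra_iff]
  constructor
  · intro hr
    obtain ⟨n, p, ψ, h, hs⟩ := exists_isPureDecomposition_sup_eq_nonclassicalNumber hρ χ
    refine ⟨n, p, ψ, h, fun i => ?_⟩
    exact ((Finset.le_sup (f := fun i => nonclassicalRank χ (ψ i)) (Finset.mem_univ i)).trans
        hs.le).trans hr
  · rintro ⟨n, p, ψ, h, hr⟩
    refine le_trans ?_ (Finset.sup_le (s := Finset.univ) fun i _ => hr i)
    exact Nat.sInf_le ⟨n, p, ψ, h, rfl⟩

theorem nonclassicalNumber_le_card [Fintype ι] [FiniteDimensional ℂ H]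
    {ρ : H →L[ℂ] H} (hρ : IsDensityOperator ρ)
    (b : Module.Basis ι ℂ H) : nonclassicalNumber b ρ ≤ Fintype.card ι := by
  obtain ⟨n, p, ψ, h, hs⟩ := exists_isPureDecomposition_sup_eq_nonclassicalNumber hρ b
  exact hs.symm.le.trans (Finset.sup_le fun i _ => nonclassicalRank_le b _)

theorem nonclassicalNumber_pos [FiniteDimensional ℂ H] {ρ : H →L[ℂ] H} (hρ : IsDensityOperator ρ)
    (b : Module.Basis ι ℂ H) : 0 < nonclassicalNumber b ρ := by
  obtain ⟨n, p, ψ, ⟨-, hp1, hψ, -⟩, hs⟩ := exists_isPureDecomposition_sup_eq_nonclassicalNumber hρ b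
  obtain ⟨i⟩ : Nonempty (Fin n) := by
    by_contra hn
    rw [not_nonempty_iff] at hn
    simp at hp1
  rw [← hs]
  exact (nonclassicalRank_pos b (hψ i)).trans_le
    (Finset.le_sup (f := fun i => nonclassicalRank b (ψ i)) (Finset.mem_univ i))

/-- The generators agree: a unit vector of rank one is a phase times some `b i`, and `ketbra`
forgets the phase. -/
theorem isClassical_iff_mem_convexHull (b : Module.Basis ι ℂ H) (hb : ∀ i, ‖b i‖ = 1)
    (ρ : H →L[ℂ] H) :
    IsClassical b ρ ↔
      ρ ∈ convexHull ℝ (ketbra '' {ψ : H | ‖ψ‖ = 1 ∧ nonclassicalRank b ψ ≤ 1}) := by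
  rw [IsClassical]
  suffices h : (Set.range fun i => ketbra (b i)) =
      ketbra '' {ψ : H | ‖ψ‖ = 1 ∧ nonclassicalRank b ψ ≤ 1} by rw [h]
  ext T
  constructor
  · rintro ⟨i, rfl⟩
    refine ⟨b i, ⟨hb i, ?_⟩, rfl⟩
    rw [nonclassicalRank_eq_card_support, b.repr_self]
    exact (Finset.card_le_card Finsupp.support_single_subset).trans (by simp)
  · rintro ⟨ψ, ⟨hψ, hr⟩, rfl⟩
    have hr1 : (b.repr ψ).support.card = 1 := by
      have := nonclassicalRank_pos b hψ
      rw [← nonclassicalRank_eq_card_support]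
      omega
    obtain ⟨i, a, -, ha⟩ := Finsupp.card_support_eq_one'.1 hr1
    have hψi : ψ = a • b i := by
      rw [← b.linearCombination_repr ψ, ha, Finsupp.linearCombination_single]
    refine ⟨i, ?_⟩
    rw [hψi, norm_smul, hb, mul_one] at hψ
    rw [hψi, ketbra_smul a hψ]

theorem isClassical_iff_nonclassicalNumber_le_one [FiniteDimensional ℂ H]
    {ρ : H →L[ℂ] H} (hρ : IsDensityOperator ρ)
    (b : Module.Basis ι ℂ H) (hb : ∀ i, ‖b i‖ = 1) :
    IsClassical b ρ ↔ nonclassicalNumber b ρ ≤ 1 := by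
  rw [isClassical_iff_mem_convexHull b hb, nonclassicalNumber_le_iff hρ]

end Rank

/-! ### Rescaling the off-diagonal part of a Gram matrix. -/

section Gram

open Matrix
open scoped ComplexOrder MatrixOrder

variable {E : Type*} [NormedAddCommGroup E] [InnerProductSpace ℂ E]
  {n : Type*} [Fintype n] [DecidableEq n]

/-- A linearly independent family stays positive definite after lowering the diagonal of its Gram
matrix slightly. -/
theorem exists_posDef_gram_sub_smul_one {v : n → E} (hv : LinearIndependent ℂ v) :
    ∃ ε : ℝ, 0 < ε ∧ ε < 1 ∧ (gram ℂ v - (ε : ℂ) • (1 : Matrix n n ℂ)).PosDef := by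
  let f : EuclideanSpace ℂ n →ₗ[ℂ] E :=
    Fintype.linearCombination ℂ v ∘ₗ (WithLp.linearEquiv 2 ℂ (n → ℂ)).toLinearMap
  have hf : Function.Injective f :=
    (LinearIndependent.fintypeLinearCombination_injective hv).comp (WithLp.linearEquiv 2 ℂ (n → ℂ)).injective
  obtain ⟨K, hK, hKf⟩ := f.exists_antilipschitzWith (LinearMap.ker_eq_bot.2 hf)
  have hKpos : (0 : ℝ) < K := hK
  have hbound : ∀ x : EuclideanSpace ℂ n, ‖x‖ ^ 2 ≤ (K : ℝ) ^ 2 * ‖f x‖ ^ 2 := fun x => by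
    rw [← mul_pow]
    exact pow_le_pow_left₀ (norm_nonneg x) (ZeroHomClass.bound_of_antilipschitz f hKf x) 2
  -- Since `‖x‖ ^ 2 ≤ K ^ 2 * ‖f x‖ ^ 2`, this `ε` gives `ε * ‖x‖ ^ 2 < ‖f x‖ ^ 2` for `x ≠ 0`; the
  -- summand 2 ensures `ε < 1`.
  refine ⟨1 / (2 + (K : ℝ) ^ 2), by positivity, ?_, ?_⟩
  · rw [div_lt_one (by positivity)]
    nlinarith [sq_nonneg (K : ℝ)]
  refine .of_dotProduct_mulVec_pos ?_ fun x hx => ?_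
  · refine (isHermitian_gram ℂ v).sub ?_
    simp [IsHermitian, conjTranspose_smul]
  · have hx' : 0 < ‖WithLp.toLp 2 x‖ := by simpa using hx
    have h1 : star x ⬝ᵥ (gram ℂ v *ᵥ x) = ((‖f (WithLp.toLp 2 x)‖ ^ 2 : ℝ) : ℂ) := by
      rw [star_dotProduct_gram_mulVec, inner_self_eq_norm_sq_to_K]
      simp [f, Fintype.linearCombination_apply]
    have h2 : star x ⬝ᵥ x = ((‖WithLp.toLp 2 x‖ ^ 2 : ℝ) : ℂ) := by
      rw [EuclideanSpace.norm_sq_eq]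
      simp [dotProduct, Complex.conj_mul']
    rw [sub_mulVec, dotProduct_sub, smul_mulVec, one_mulVec, dotProduct_smul, h1, h2, smul_eq_mul,
      ← Complex.ofReal_mul, ← Complex.ofReal_sub]
    rw [Complex.zero_lt_real, sub_pos, div_mul_eq_mul_div, one_mul, div_lt_iff₀ (by positivity)]
    have := hbound (WithLp.toLp 2 x)
    have hpos : 0 < ‖f (WithLp.toLp 2 x)‖ ^ 2 := by
      by_contra h
      have : ‖f (WithLp.toLp 2 x)‖ ^ 2 = 0 := le_antisymm (not_lt.1 h) (sq_nonneg _)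
      nlinarith
    nlinarith

theorem Matrix.PosDef.exists_conjTranspose_mul_self {A : Matrix n n ℂ} (hA : A.PosDef) :
    ∃ B : Matrix n n ℂ, Bᴴ * B = A ∧ IsUnit B := by
  obtain ⟨B, hB⟩ := CStarAlgebra.nonneg_iff_eq_star_mul_self.mp hA.posSemidef.nonneg
  refine ⟨B, hB.symm, ?_⟩
  have := hA.isUnit
  rw [hB, isUnit_iff_isUnit_det, det_mul] at this
  rw [isUnit_iff_isUnit_det]
  exact isUnit_of_mul_isUnit_right this

/-- Vectors whose Gram matrix is that of `v` with the off-diagonal entries divided by `c ^ 2`. -/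
theorem exists_gram_rescaled {v : n → E} (hv : LinearIndependent ℂ v) (hnorm : ∀ i, ‖v i‖ = 1) :
    ∃ (c s : ℝ) (B : Matrix n n ℂ), c ≠ 0 ∧ s ≠ 0 ∧ c ^ 2 + s ^ 2 = 1 ∧ IsUnit B ∧
      (∀ i, ∑ a, star (B a i) * B a i = 1) ∧
      ∀ i j, i ≠ j → (∑ a, star (B a i) * B a j) * (c : ℂ) ^ 2 = inner ℂ (v i) (v j) := by
  obtain ⟨ε, hε, hε1, hpos⟩ := exists_posDef_gram_sub_smul_one hv
  obtain ⟨B, hB, hBu⟩ := hpos.exists_conjTranspose_mul_self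
  have h1ε : 0 < 1 - ε := by linarith
  have hc : Real.sqrt (1 - ε) ≠ 0 := (Real.sqrt_pos.2 h1ε).ne'
  have hcsq : ((Real.sqrt (1 - ε) : ℝ) : ℂ) * ((Real.sqrt (1 - ε) : ℝ) : ℂ) = ((1 - ε : ℝ) : ℂ) := by
    rw [← Complex.ofReal_mul, Real.mul_self_sqrt h1ε.le]
  have hc' : ((1 - ε : ℝ) : ℂ) ≠ 0 := Complex.ofReal_ne_zero.2 h1ε.ne'
  have hentry : ∀ i j, ∑ a, star (B a i) * B a j =
      inner ℂ (v i) (v j) - (ε : ℂ) * (1 : Matrix n n ℂ) i j := fun i j => by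
    have := congrFun (congrFun hB i) j
    simpa [mul_apply, conjTranspose_apply] using this
  have hinv : star (((Real.sqrt (1 - ε) : ℝ) : ℂ)⁻¹) = ((Real.sqrt (1 - ε) : ℝ) : ℂ)⁻¹ := by
    rw [star_inv₀]; simp
  have hsum : ∀ i j, (∑ a, star ((((Real.sqrt (1 - ε) : ℝ) : ℂ)⁻¹ • B) a i) *
      (((Real.sqrt (1 - ε) : ℝ) : ℂ)⁻¹ • B) a j) * ((1 - ε : ℝ) : ℂ) =
      inner ℂ (v i) (v j) - (ε : ℂ) * (1 : Matrix n n ℂ) i j := fun i j => by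
    rw [← hentry, Finset.sum_mul]
    refine Finset.sum_congr rfl fun a _ => ?_
    rw [Matrix.smul_apply, Matrix.smul_apply, smul_eq_mul, smul_eq_mul, star_mul, hinv, ← hcsq]
    have : ((Real.sqrt (1 - ε) : ℝ) : ℂ) ≠ 0 := Complex.ofReal_ne_zero.2 hc
    field_simp
  -- Lowering the diagonal by `ε` leaves `1 - ε = c ^ 2` there; dividing by `c ^ 2` restores unit
  -- columns.
  refine ⟨Real.sqrt (1 - ε), Real.sqrt ε, ((Real.sqrt (1 - ε) : ℝ) : ℂ)⁻¹ • B, hc,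
    (Real.sqrt_pos.2 hε).ne', ?_, ?_, fun i => ?_, fun i j hij => ?_⟩
  · rw [Real.sq_sqrt h1ε.le, Real.sq_sqrt hε.le]; ring
  · exact hBu.smul (Units.mk0 _ (inv_ne_zero (Complex.ofReal_ne_zero.2 hc)))
  · refine mul_right_cancel₀ hc' ?_
    rw [hsum, inner_self_eq_norm_sq_to_K, hnorm]
    simp
  · rw [sq, hcsq, hsum]
    simp [hij]

end Gram

/-! ### Building and testing product vectors. -/

section Producible

variable {P : Type*} [Fintype P] [DecidableEq P] {dim : P → ℕ}

/-- A vector is producible if it is the product of a factor on the parties `T` with single-party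
factors on the others. -/
theorem isProducibleVector_of_eq_mul_prod {k : ℕ} {ψ : CompositeSpace dim} (T : Finset P)
    (hT : T.Nonempty) (hk : T.card ≤ k) (f : ∀ B : Finset P, CompositeSpace (fun p : B => dim p))
    (u : ∀ p, Fin (dim p) → ℂ)
    (h : ∀ x, ψ x = f T (fun p => x p) * ∏ p ∈ Tᶜ, u p (x p)) : IsProducibleVector k ψ := by
  let π : Finpartition (Finset.univ : Finset P) :=
    (⊥ : Finpartition Tᶜ).extend (b := T) hT.ne_empty disjoint_compl_left (by simp)
  have hπ : π.parts = insert T (⊥ : Finpartition Tᶜ).parts := rfl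
  have hne : ∀ p ∈ Tᶜ, ({p} : Finset P) ≠ T := by
    rintro p hp rfl
    simp at hp
  refine ⟨π, ?_, fun B => if B = T then f B else WithLp.toLp 2 fun y => ∏ p : B, u p (y p),
    fun x => ?_⟩
  · intro B hB
    rw [hπ, Finset.mem_insert, Finpartition.parts_bot, Finset.mem_map] at hB
    rcases hB with rfl | ⟨p, -, rfl⟩
    · exact hk
    · exact (Finset.card_singleton p).le.trans ((Finset.card_pos.2 hT).trans_le hk)
  · rw [hπ, Finset.prod_insert]
    · beta_reduce
      rw [if_pos rfl, h, Finpartition.parts_bot, Finset.prod_map]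
      congr 1
      refine Finset.prod_congr rfl fun p hp => ?_
      simp only [Function.Embedding.coeFn_mk]
      rw [if_neg (hne p hp)]
      simp
    · rw [Finpartition.parts_bot, Finset.mem_map]
      rintro ⟨p, hp, hpT⟩
      exact hne p hp hpT

/-- Exchanging the coordinates in one block between two arguments of a product vector preserves
the product of the two values. -/
theorem mul_eq_mul_of_swap_block {ψ : CompositeSpace dim}
    {π : Finpartition (Finset.univ : Finset P)}
    {φ : ∀ B : Finset P, CompositeSpace (fun p : B => dim p)}
    (h : ∀ x, ψ x = ∏ B ∈ π.parts, φ B (fun p => x p)) {B : Finset P} (hB : B ∈ π.parts)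
    {x y z w : ∀ p, Fin (dim p)} (hxz : ∀ p, p ∉ B → x p = z p) (hyw : ∀ p, p ∉ B → y p = w p)
    (hxw : ∀ p ∈ B, x p = w p) (hyz : ∀ p ∈ B, y p = z p) :
    ψ x * ψ y = ψ z * ψ w := by
  have hoff : ∀ {u v : ∀ p, Fin (dim p)}, (∀ p, p ∉ B → u p = v p) →
      ∏ C ∈ π.parts.erase B, φ C (fun p => u p) = ∏ C ∈ π.parts.erase B, φ C (fun p => v p) := by
    intro u v huv
    refine Finset.prod_congr rfl fun C hC => ?_
    obtain ⟨hCB, hC⟩ := Finset.mem_erase.1 hC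
    refine congrArg (φ C) (funext fun p => ?_)
    exact huv p fun hp => hCB (π.eq_of_mem_parts hC hB p.2 hp)
  have hon : ∀ {u v : ∀ p, Fin (dim p)}, (∀ p ∈ B, u p = v p) →
      φ B (fun p => u p) = φ B (fun p => v p) := by
    intro u v huv
    exact congrArg (φ B) (funext fun p => huv p p.2)
  simp only [h, ← Finset.mul_prod_erase _ _ hB]
  rw [hoff hxz, hoff hyw, hon hxw, hon hyz]
  ring

end Producible

/-! ### The isometry and its effect on entanglement depth. -/

section Conversion

variable {d m : ℕ}

/-- Single-party factors of the image of the `i`-th classical state: column `i` of `B` on the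
system, `c |0⟩ + s |1⟩` on the `i`-th ancilla and `|0⟩` on the others. -/
def localFactor (B : Matrix (Fin d) (Fin d) ℂ) (c s : ℂ) (i : Fin d) :
    ∀ p : Option (Fin d), Fin (ancillaDims d m p) → ℂ
  | none => fun a => B a i
  | some j => fun t =>
      if j = i then (if t.val = 0 then c else if t.val = 1 then s else 0)
      else if t.val = 0 then 1 else 0

/-- The fully separable image of the `i`-th classical state. -/
def productImage (m : ℕ) (B : Matrix (Fin d) (Fin d) ℂ) (c s : ℂ) (i : Fin d) :
    CompositeSpace (ancillaDims d m) :=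
  WithLp.toLp 2 fun x => ∏ p, localFactor B c s i p (x p)

/-- The product-basis label with system label `a` and ancilla labels `v`. -/
def basisLabel (a : Fin d) (v : Fin d → Fin m) : ∀ p : Option (Fin d), Fin (ancillaDims d m p)
  | none => a
  | some j => v j

theorem inner_prod_prod {P : Type*} [Fintype P] [DecidableEq P] {dim : P → ℕ}
    (f g : ∀ p, Fin (dim p) → ℂ) :
    inner ℂ (WithLp.toLp 2 fun x => ∏ p, f p (x p) : CompositeSpace dim)
      (WithLp.toLp 2 fun x => ∏ p, g p (x p)) = ∏ p, ∑ t, star (f p t) * g p t := by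
  rw [Finset.prod_univ_sum, Fintype.piFinset_univ, PiLp.inner_apply]
  refine Finset.sum_congr rfl fun x _ => ?_
  simp [Finset.prod_mul_distrib, mul_comm]

/-- For `i ≠ j`, ancillas `i` and `j` each pair `c|0⟩ + s|1⟩` with `|0⟩`, giving `c`. Levels above 1
carry no amplitude. -/
theorem sum_star_localFactor_mul {m : ℕ} (B : Matrix (Fin d) (Fin d) ℂ) {c s : ℝ}
    (hcs : c ^ 2 + s ^ 2 = 1) (i j k : Fin d) :
    ∑ t : Fin (m + 2), star (localFactor (m := m + 2) B c s i (some k) t) *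
      localFactor (m := m + 2) B c s j (some k) t =
      if i = j then 1 else if k = i then (c : ℂ) else if k = j then (c : ℂ) else 1 := by
  have hcs' : (c : ℂ) * c + s * s = 1 := by
    rw [← sq, ← sq]; exact_mod_cast hcs
  rw [Fin.sum_univ_succ, Fin.sum_univ_succ]
  have h : ∀ t : Fin m, star (localFactor (m := m + 2) B c s i (some k) t.succ.succ) *
      localFactor (m := m + 2) B c s j (some k) t.succ.succ = 0 := fun t => by
    simp [localFactor]
  rw [Finset.sum_eq_zero fun t _ => h t]
  simp only [localFactor, Fin.val_zero, Fin.val_succ]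
  by_cases hij : i = j
  · subst hij
    by_cases hk : k = i <;> simp [hk, hcs']
  · by_cases hi : k = i
    · subst hi
      simp [hij]
    · by_cases hj : k = j
      · subst hj
        simp [hi, hij]
      · simp [hi, hj, hij]

theorem inner_productImage (B : Matrix (Fin d) (Fin d) ℂ) {c s : ℝ}
    (hcs : c ^ 2 + s ^ 2 = 1) (i j : Fin d) :
    inner ℂ (productImage (m + 2) B c s i) (productImage (m + 2) B c s j) =
      (∑ a, star (B a i) * B a j) * if i = j then 1 else (c : ℂ) ^ 2 := by
  rw [productImage, productImage, inner_prod_prod, Fintype.prod_option]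
  congr 1
  refine (Finset.prod_congr rfl fun k _ => sum_star_localFactor_mul B hcs i j k).trans ?_
  by_cases hij : i = j
  · simp [hij]
  · have : ∀ k, (if i = j then 1 else if k = i then (c : ℂ) else if k = j then (c : ℂ) else 1) =
        (if k = i then (c : ℂ) else 1) * (if k = j then (c : ℂ) else 1) := by
      intro k
      by_cases hi : k = i
      · subst hi; simp [hij]
      · simp [hi, hij]
    simp_rw [this, Finset.prod_mul_distrib]
    simp [hij, sq]

theorem exists_isometry_map_eq_productImage (hm : 2 ≤ m)
    (b : Module.Basis (Fin d) ℂ (EuclideanSpace ℂ (Fin d))) (hb : ∀ i, ‖b i‖ = 1) :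
    ∃ (c s : ℂ) (B : Matrix (Fin d) (Fin d) ℂ)
      (Λ : EuclideanSpace ℂ (Fin d) →ₗᵢ[ℂ] CompositeSpace (ancillaDims d m)),
      c ≠ 0 ∧ s ≠ 0 ∧ IsUnit B ∧ ∀ i, Λ (b i) = productImage m B c s i := by
  obtain ⟨m, rfl⟩ := Nat.exists_eq_add_of_le' hm
  obtain ⟨c, s, B, hc, hs, hcs, hB, h1, hne⟩ := exists_gram_rescaled b.linearIndependent hb
  have hinner : ∀ i j, inner ℂ (productImage (m + 2) B c s i) (productImage (m + 2) B c s j) =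
      inner ℂ (b i) (b j) := by
    intro i j
    rw [inner_productImage B hcs]
    by_cases hij : i = j
    · subst hij
      rw [if_pos rfl, mul_one, h1, inner_self_eq_norm_sq_to_K, hb]
      simp
    · rw [if_neg hij, hne i j hij]
  let f := b.constr ℂ (productImage (m + 2) B c s)
  refine ⟨c, s, B, f.isometryOfInner fun x y => ?_, Complex.ofReal_ne_zero.2 hc,
    Complex.ofReal_ne_zero.2 hs, hB, fun i => b.constr_basis ℂ _ i⟩
  rw [← b.sum_repr x, ← b.sum_repr y]
  simp only [map_sum, map_smul, sum_inner, inner_sum, inner_smul_left, inner_smul_right]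
  simp only [f, b.constr_basis, hinner]

section Pure

variable {B : Matrix (Fin d) (Fin d) ℂ} {c s : ℂ}
  {b : Module.Basis (Fin d) ℂ (EuclideanSpace ℂ (Fin d))}
  {Λ : EuclideanSpace ℂ (Fin d) →ₗᵢ[ℂ] CompositeSpace (ancillaDims d m)}

theorem map_apply_eq_sum (hΛ : ∀ i, Λ (b i) = productImage m B c s i)
    (ψ : EuclideanSpace ℂ (Fin d)) (x : ∀ p, Fin (ancillaDims d m p)) :
    Λ ψ x = ∑ i ∈ (b.repr ψ).support, b.repr ψ i * ∏ p, localFactor B c s i p (x p) := by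
  conv_lhs => rw [← b.linearCombination_repr ψ, Finsupp.linearCombination_apply, Finsupp.sum,
    map_sum]
  simp [hΛ, productImage]

theorem isProducibleVector_map (hΛ : ∀ i, Λ (b i) = productImage m B c s i)
    (ψ : EuclideanSpace ℂ (Fin d)) :
    IsProducibleVector (nonclassicalRank b ψ + 1) (Λ ψ) := by
  classical
  let T : Finset (Option (Fin d)) := Finset.insertNone (b.repr ψ).support
  refine isProducibleVector_of_eq_mul_prod T ⟨none, by simp [T]⟩
    (by rw [nonclassicalRank_eq_card_support, Finset.card_insertNone])
    (fun C => WithLp.toLp 2 fun y => ∑ i ∈ (b.repr ψ).support,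
      b.repr ψ i * ∏ p : C, localFactor B c s i p (y p))
    (fun p t => if t.val = 0 then 1 else 0) fun x => ?_
  rw [map_apply_eq_sum hΛ, Finset.sum_mul]
  refine Finset.sum_congr rfl fun i hi => ?_
  rw [mul_assoc, ← Finset.prod_mul_prod_compl T]
  congr 2
  · exact (Finset.prod_coe_sort T fun p => localFactor B c s i p (x p)).symm
  · refine Finset.prod_congr rfl fun p hp => ?_
    cases p with
    | none => simp [T] at hp
    | some j =>
      have : j ≠ i := by
        rintro rfl
        exact (Finset.mem_compl.1 hp) (Finset.some_mem_insertNone.2 hi)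
      simp [localFactor, this]

/-- For rank one the general bound 2 improves to 1, which is the source of the `max 1` in the later
equivalences. -/
theorem isProducibleVector_one_map (hΛ : ∀ i, Λ (b i) = productImage m B c s i)
    {ψ : EuclideanSpace ℂ (Fin d)} (hψ : nonclassicalRank b ψ = 1) :
    IsProducibleVector 1 (Λ ψ) := by
  rw [nonclassicalRank_eq_card_support, Finset.card_eq_one] at hψ
  obtain ⟨i, hi⟩ := hψ
  refine isProducibleVector_of_eq_mul_prod {none} ⟨none, by simp⟩ (by simp)
    (fun C => WithLp.toLp 2 fun y => b.repr ψ i * ∏ p : C, localFactor B c s i p (y p))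
    (localFactor B c s i) fun x => ?_
  rw [map_apply_eq_sum hΛ, hi, Finset.sum_singleton, ← Finset.prod_mul_prod_compl {none},
    ← mul_assoc]
  congr 2

theorem IsProducibleVector.mono {P : Type*} [Fintype P] [DecidableEq P] {dim : P → ℕ} {k l : ℕ}
    (hkl : k ≤ l) {ψ : CompositeSpace dim} (h : IsProducibleVector k ψ) :
    IsProducibleVector l ψ := by
  obtain ⟨π, hπ, hφ⟩ := h
  exact ⟨π, fun C hC => (hπ C hC).trans hkl, hφ⟩

/-- Contracting the system with the dual of the `i`-th column isolates the `i`-th term. -/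
theorem sum_inv_mul_map_apply (hΛ : ∀ i, Λ (b i) = productImage m B c s i) (hB : IsUnit B)
    (ψ : EuclideanSpace ℂ (Fin d)) (i : Fin d) (v : Fin d → Fin m) :
    ∑ a, B⁻¹ i a * Λ ψ (basisLabel a v) =
      b.repr ψ i * ∏ k, localFactor (m := m) B c s i (some k) (v k) := by
  have hinv : ∀ j, ∑ a, B⁻¹ i a * B a j = (1 : Matrix (Fin d) (Fin d) ℂ) i j := fun j => by
    rw [← Matrix.nonsing_inv_mul B ((Matrix.isUnit_iff_isUnit_det B).1 hB), Matrix.mul_apply]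
  have hexp : ∀ a, Λ ψ (basisLabel a v) = ∑ j, b.repr ψ j *
      (B a j * ∏ k, localFactor (m := m) B c s j (some k) (v k)) := fun a => by
    rw [map_apply_eq_sum hΛ]
    refine (Finset.sum_subset (Finset.subset_univ _) fun j _ hj => ?_).trans ?_
    · rw [Finsupp.notMem_support_iff.1 hj, zero_mul]
    · refine Finset.sum_congr rfl fun j _ => ?_
      rw [Fintype.prod_option]
      rfl
  simp_rw [hexp, Finset.mul_sum]
  rw [Finset.sum_comm]
  have : ∀ j, ∑ a, B⁻¹ i a * (b.repr ψ j *
      (B a j * ∏ k, localFactor (m := m) B c s j (some k) (v k))) =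
      (1 : Matrix (Fin d) (Fin d) ℂ) i j *
        (b.repr ψ j * ∏ k, localFactor (m := m) B c s j (some k) (v k)) := fun j => by
    rw [← hinv, Finset.sum_mul]
    exact Finset.sum_congr rfl fun a _ => by ring
  simp_rw [this, Matrix.one_apply]
  simp

/-- If ancilla `j` of the support lay outside the system's block, its state could be swapped
independently of the system. But `|1⟩` on ancilla `j` occurs only in the `j`-th term, while `|0⟩`
everywhere also occurs with any other `i` in the support. -/
theorem nonclassicalRank_lt_of_isProducibleVector (hm : 2 ≤ m) (hc : c ≠ 0) (hs : s ≠ 0)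
    (hB : IsUnit B) (hΛ : ∀ i, Λ (b i) = productImage m B c s i)
    {ψ : EuclideanSpace ℂ (Fin d)} (hψ : 2 ≤ nonclassicalRank b ψ) {l : ℕ}
    (h : IsProducibleVector l (Λ ψ)) : nonclassicalRank b ψ + 1 ≤ l := by
  classical
  obtain ⟨m, rfl⟩ := Nat.exists_eq_add_of_le' hm
  obtain ⟨π, hπ, φ, hφ⟩ := h
  rw [nonclassicalRank_eq_card_support] at hψ ⊢
  obtain ⟨A, hA, hnone⟩ := π.exists_mem (Finset.mem_univ none)
  suffices hsub : Finset.insertNone (b.repr ψ).support ⊆ A by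
    rw [← Finset.card_insertNone]
    exact (Finset.card_le_card hsub).trans (hπ A hA)
  intro p hp
  cases p with
  | none => exact hnone
  | some j =>
    have hj : j ∈ (b.repr ψ).support := Finset.some_mem_insertNone.1 hp
    by_contra hjA
    obtain ⟨C, hC, hjC⟩ := π.exists_mem (Finset.mem_univ (some j))
    have hnC : none ∉ C := fun hn => hjA (π.eq_of_mem_parts hC hA hn hnone ▸ hjC)
    obtain ⟨i, hi, hij⟩ := Finset.exists_mem_ne (Nat.lt_of_succ_le hψ) j
    let v : Fin d → Fin (m + 2) := Pi.single j 1
    have hswap : ∀ a a', Λ ψ (basisLabel a v) * Λ ψ (basisLabel a' 0) =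
        Λ ψ (basisLabel a 0) * Λ ψ (basisLabel a' v) := by
      intro a a'
      have hv : ∀ k, some k ∉ C → v k = 0 := fun k hk => by
        have : k ≠ j := by rintro rfl; exact hk hjC
        simp [v, this]
      refine mul_eq_mul_of_swap_block hφ hC ?_ ?_ ?_ ?_
      · rintro (_ | k) hk
        · rfl
        · exact hv k hk
      · rintro (_ | k) hk
        · rfl
        · exact (hv k hk).symm
      · rintro (_ | k) hk
        · exact absurd hk hnC
        · rfl
      · rintro (_ | k) hk
        · exact absurd hk hnC
        · rfl
    -- Contracting the two system labels with dual columns `i` and `j` turns the swap identity into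
    -- one between single coefficients: the left side is 0, the right side `ψ_i c ψ_j s ≠ 0`.
    have hprod : (∑ a, B⁻¹ i a * Λ ψ (basisLabel a v)) * ∑ a, B⁻¹ j a * Λ ψ (basisLabel a 0) =
        (∑ a, B⁻¹ i a * Λ ψ (basisLabel a 0)) * ∑ a, B⁻¹ j a * Λ ψ (basisLabel a v) := by
      rw [Finset.sum_mul_sum, Finset.sum_mul_sum]
      refine Finset.sum_congr rfl fun a _ => Finset.sum_congr rfl fun a' _ => ?_
      linear_combination (B⁻¹ i a * B⁻¹ j a') * hswap a a'
    simp only [sum_inv_mul_map_apply hΛ hB] at hprod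
    have hzero : ∏ k, localFactor (m := m + 2) B c s i (some k) (v k) = 0 := by
      refine Finset.prod_eq_zero (Finset.mem_univ j) ?_
      simp [localFactor, v, hij.symm]
    have hconst : ∀ i, ∏ k, localFactor (m := m + 2) B c s i (some k)
        ((0 : Fin d → Fin (m + 2)) k) = c := by
      intro i
      simp [localFactor]
    have hflip : ∏ k, localFactor (m := m + 2) B c s j (some k) (v k) = s := by
      rw [Finset.prod_eq_single j]
      · simp [localFactor, v]
      · intro k _ hk
        simp [localFactor, v, hk]
      · simp
    rw [hzero, hflip, hconst i, mul_zero, zero_mul] at hprod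
    exact mul_ne_zero (mul_ne_zero (Finsupp.mem_support_iff.1 hi) hc)
      (mul_ne_zero (Finsupp.mem_support_iff.1 hj) hs) hprod.symm

theorem isProducibleVector_map_iff (hm : 2 ≤ m) (hc : c ≠ 0) (hs : s ≠ 0)
    (hB : IsUnit B) (hΛ : ∀ i, Λ (b i) = productImage m B c s i)
    {ψ : EuclideanSpace ℂ (Fin d)} (hψ : ‖ψ‖ = 1) {l : ℕ} (hl : 1 ≤ l) :
    IsProducibleVector l (Λ ψ) ↔ nonclassicalRank b ψ ≤ max 1 (l - 1) := by
  have hpos := nonclassicalRank_pos b hψ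
  constructor
  · intro h
    by_cases h2 : 2 ≤ nonclassicalRank b ψ
    · have := nonclassicalRank_lt_of_isProducibleVector hm hc hs hB hΛ h2 h
      omega
    · omega
  · intro h
    by_cases h1 : nonclassicalRank b ψ = 1
    · exact (isProducibleVector_one_map hΛ h1).mono hl
    · exact (isProducibleVector_map hΛ ψ).mono (by omega)

theorem isProducible_conjugateBy_iff (hm : 2 ≤ m) (hc : c ≠ 0) (hs : s ≠ 0)
    (hB : IsUnit B) (hΛ : ∀ i, Λ (b i) = productImage m B c s i)
    {ρ : EuclideanSpace ℂ (Fin d) →L[ℂ] EuclideanSpace ℂ (Fin d)} (hρ : IsDensityOperator ρ)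
    {l : ℕ} (hl : 1 ≤ l) :
    IsProducible l (conjugateBy Λ ρ) ↔ nonclassicalNumber b ρ ≤ max 1 (l - 1) := by
  rw [IsProducible, conjugateBy_mem_convexHull_ketbra_iff, nonclassicalNumber_le_iff hρ]
  have : {ψ : EuclideanSpace ℂ (Fin d) | ‖ψ‖ = 1 ∧ IsProducibleVector l (Λ ψ)} =
      {ψ | ‖ψ‖ = 1 ∧ nonclassicalRank b ψ ≤ max 1 (l - 1)} := by
    ext ψ
    exact and_congr_right fun hψ => isProducibleVector_map_iff hm hc hs hB hΛ hψ hl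
  rw [this]

end Pure

end Conversion

theorem theorem1 (d m : ℕ) (hm : 2 ≤ m)
    (χ : Fin d → EuclideanSpace ℂ (Fin d))
    (hnorm : ∀ i, ‖χ i‖ = 1)
    (hlin : LinearIndependent ℂ χ)
    (hspan : Submodule.span ℂ (Set.range χ) = ⊤) :
    ∃ Λ : EuclideanSpace ℂ (Fin d) →ₗᵢ[ℂ] CompositeSpace (ancillaDims d m),
      ∀ ρ : EuclideanSpace ℂ (Fin d) →L[ℂ] EuclideanSpace ℂ (Fin d), IsDensityOperator ρ →
        (∀ k : ℕ, nonclassicalNumber χ ρ = k →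
          (IsGenuinelyPartiteEntangled (k + 1) (conjugateBy Λ ρ) ↔ ¬ IsClassical χ ρ) ∧
          (¬ IsClassical χ ρ ↔ 2 ≤ k ∧ k ≤ d) ∧
          (IsFullySeparable (conjugateBy Λ ρ) ↔ IsClassical χ ρ) ∧
          (IsClassical χ ρ ↔ k = 1)) ∧
        (∀ k : ℕ, 2 ≤ k → k ≤ d →
          (IsGenuinelyPartiteEntangled (k + 1) (conjugateBy Λ ρ) ↔
            nonclassicalNumber χ ρ = k)) := by
  obtain ⟨b, rfl⟩ : ∃ b : Module.Basis (Fin d) ℂ (EuclideanSpace ℂ (Fin d)), ⇑b = χ :=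
    ⟨Module.Basis.mk hlin hspan.ge, Module.Basis.coe_mk hlin hspan.ge⟩
  obtain ⟨c, s, B, Λ, hc, hs, hB, hΛ⟩ := exists_isometry_map_eq_productImage hm b hnorm
  refine ⟨Λ, fun ρ hρ => ?_⟩
  have hpos := nonclassicalNumber_pos hρ b
  have hle : nonclassicalNumber b ρ ≤ d := by
    simpa using nonclassicalNumber_le_card hρ b
  have hcl := isClassical_iff_nonclassicalNumber_le_one hρ b hnorm
  have hprod : ∀ {l : ℕ}, 1 ≤ l →
      (IsProducible l (conjugateBy Λ ρ) ↔ nonclassicalNumber b ρ ≤ max 1 (l - 1)) :=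
    fun hl => isProducible_conjugateBy_iff hm hc hs hB hΛ hρ hl
  have hgen : ∀ {k : ℕ}, 1 ≤ k → (IsGenuinelyPartiteEntangled (k + 1) (conjugateBy Λ ρ) ↔
      nonclassicalNumber b ρ ≤ k ∧ ¬ nonclassicalNumber b ρ ≤ max 1 (k - 1)) := by
    intro k hk
    rw [IsGenuinelyPartiteEntangled, Nat.add_sub_cancel, hprod hk, hprod (by omega),
      Nat.add_sub_cancel, max_eq_right hk]
  refine ⟨?_, fun k hk _ => ?_⟩
  · rintro k rfl
    refine ⟨?_, ?_, ?_, ?_⟩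
    -- At `k = 1` the truncated bound `max 1 (k - 1)` equals `k`, so depth 2 never occurs.
    · rw [hgen hpos, hcl]; omega
    · rw [hcl]; omega
    · rw [IsFullySeparable, hprod le_rfl, hcl]; simp
    · rw [hcl]; omega
  · rw [hgen (by omega)]; omega
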